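/- Let $\mu$ be normalized arclength measure on the unit circle $\mathbb T$, let $\chi(z)=z$, write $f^*$ for the complex conjugate $\overline f$ of a function $f$ on $\mathbb T$, and let $H^2\subset L^2(\mathbb T)$ be the Hardy space, that is, the space of $f\in L^2(\mathbb T)$ whose Fourier coefficients $\widehat f(n)$ vanish for $n<0$. For $g\in H^2$, $g(0)$ and $g'(0)$ denote the values at $0$ of the analytic function $\sum_{n\ge 0}\widehat g(n)z^n$ on the disc and of its derivative. A function $g\in H^2$ is *outer* if $\{ag : a\in A(\mathbb D)\}$ is dense in $H^2$, where $A(\mathbb D)$ is the disc algebra (functions continuous on the closed unit disc and analytic in its interior). For a linear subspace $\mathcal V\subset\mathbb C\oplus\mathbb Cz$ put $H^2_{\mathcal V}=H^2\ominus\mathcal V=\{f\in H^2 : f\perp\mathcal V\}$, and for a real-valued $\varphi\in L^\infty(\mathbb T)$ let $T^{\mathcal V}_\varphi f=P_{\mathcal V}(\varphi f)$ for $f\in H^2_{\mathcal V}$, where $P_{\mathcal V}$ is the orthogonal projection of $L^2(\mathbb T)$ onto $H^2_{\mathcal V}$. **Theorem.** Let $\varphi\in L^\infty(\mathbb T)$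 be real-valued and not almost everywhere zero. 1. Let $\mathcal V\subset\mathbb C\oplus\mathbb Cz$ be a subspace and let $g\in H^2_{\mathcal V}$ be nonzero. If $T^{\mathcal V}_\varphi g=0$, then $g$ is outer and there is a $c\in\mathbb C$ such that $$\varphi|g|^2=c\chi+(c\chi)^*\quad\text{almost everywhere on }\mathbb T.\tag{1}$$ 2. Conversely, let $c\in\mathbb C$ and let $g\in H^2$ be an outer function such that (1) holds. Then there is exactly one subspace $\mathcal V\subset\mathbb C\oplus\mathbb Cz$ such that $g\in H^2_{\mathcal V}$ and $T^{\mathcal V}_\varphi g=0$, and it is determined by $g(0)$ and $g'(0)$: it is the orthogonal complement in $\mathbb C\oplus\mathbb Cz$ of the vector $g(0)+g'(0)z$. 3. There is at most one subspace $\mathcal V\subset\mathbb C\oplus\mathbb Cz$ such that $T^{\mathcal V}_\varphi$ has eigenvalue $0$, and for every $\mathcal V$ the kernel of $T^{\mathcal V}_\varphi$ has dimension at most one. -/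

import Mathlib

noncomputable section

namespace NeilToeplitz

open MeasureTheory
open scoped ENNReal ComplexConjugate

/-- Normalized arclength measure on the unit circle `𝕋`. The circle is parametrized by
`x ∈ ℝ / ℤ` through `x ↦ exp (2 π i x)`, which is `AddCircle.toCircle`. -/
abbrev arc : Measure UnitAddCircle := AddCircle.haarAddCircle

/-- The coordinate function `χ(z) = z` on the circle. -/
def chi (x : UnitAddCircle) : ℂ := (AddCircle.toCircle x : ℂ)

/-- The Hilbert space `L²(𝕋)`. -/
abbrev L2 : Type := Lp ℂ 2 arc

/-- The space of real-valued functions in `L^∞(𝕋)`. -/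
abbrev RealLinf : Type := Lp ℝ ∞ arc

theorem fourierCoeff_eq_inner (f : L2) (n : ℤ) :
    fourierCoeff f n = inner ℂ (fourierLp (T := 1) 2 n) f := by
  rw [← fourierBasis_repr, HilbertBasis.repr_apply_apply, coe_fourierBasis]

/-- The Hardy space `H²`, as a subspace of `L²(𝕋)`: the functions whose Fourier coefficients
of negative index vanish. -/
def H2 : Submodule ℂ L2 where
  carrier := {f | ∀ n : ℤ, n < 0 → fourierCoeff f n = 0}
  zero_mem' := by
    intro n _
    rw [fourierCoeff_eq_inner, inner_zero_right]
  add_mem' := by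
    intro f g hf hg n hn
    rw [fourierCoeff_eq_inner, inner_add_right, ← fourierCoeff_eq_inner,
      ← fourierCoeff_eq_inner, hf n hn, hg n hn, add_zero]
  smul_mem' := by
    intro c f hf n hn
    rw [fourierCoeff_eq_inner, inner_smul_right, ← fourierCoeff_eq_inner, hf n hn, mul_zero]

theorem isClosed_H2 : IsClosed (H2 : Set L2) := by
  have h : (H2 : Set L2) =
      ⋂ (n : ℤ) (_ : n < 0), {f : L2 | inner ℂ (fourierLp (T := 1) 2 n) f = 0} := by
    ext f
    simp only [Set.mem_iInter, Set.mem_ofPred_eq, ← fourierCoeff_eq_inner]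
    rfl
  rw [h]
  refine isClosed_iInter fun n => isClosed_iInter fun _ => ?_
  exact isClosed_eq (continuous_const.inner continuous_id) continuous_const

/-- The analytic function on the unit disc given by the Taylor series
`∑ f̂(n) zⁿ`, `n ≥ 0`. For `f ∈ H²` this is the function on the disc with boundary values `f`. -/
def toDisc (f : L2) (z : ℂ) : ℂ := ∑' n : ℕ, fourierCoeff f (n : ℤ) * z ^ n

/-- The two-dimensional space `ℂ ⊕ ℂ z ⊆ L²(𝕋)` spanned by the functions `1` and `z`. -/
def affinePolys : Submodule ℂ L2 :=
  Submodule.span ℂ {fourierLp (T := 1) 2 0, fourierLp (T := 1) 2 1}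

/-- `H²_𝒱 = H² ⊖ 𝒱`, the functions in `H²` that are orthogonal to `𝒱`. -/
def H2V (V : Submodule ℂ L2) : Submodule ℂ L2 := H2 ⊓ Vᗮ

instance completeSpace_H2V (V : Submodule ℂ L2) : CompleteSpace (H2V V) :=
  (isClosed_H2.inter V.isClosed_orthogonal).completeSpace_coe

theorem mul_smul_L2 (φ : RealLinf) (c : ℂ) (f : L2) :
    (φ • (c • f) : L2) = c • (φ • f : L2) := by
  apply Lp.ext
  filter_upwards [Lp.coeFn_lpSMul (r := 2) φ (c • f), Lp.coeFn_lpSMul (r := 2) φ f,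
    Lp.coeFn_smul c f, Lp.coeFn_smul c (φ • f : L2)] with x h1 h2 h3 h4
  rw [h1, h4, Pi.smul_apply', h3, Pi.smul_apply, Pi.smul_apply, h2, Pi.smul_apply', smul_comm]

/-- The Toeplitz operator `f ↦ P_𝒱 (φ f)` on `H²_𝒱`, where `P_𝒱` is the orthogonal projection of
`L²(𝕋)` onto `H²_𝒱`. -/
def toeplitz (φ : RealLinf) (V : Submodule ℂ L2) : H2V V →ₗ[ℂ] H2V V where
  toFun f := (H2V V).orthogonalProjectionOnto (φ • (f : L2) : L2)
  map_add' f g := by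
    rw [Submodule.coe_add, Lp.add_smul, map_add]
  map_smul' c f := by
    rw [Submodule.coe_smul, RingHom.id_apply, mul_smul_L2, map_smul]

/-- `f ∈ L²(𝕋)` agrees almost everywhere with `a g` for some `a` in the disc algebra `A(𝔻)`
(continuous on the closed unit disc and analytic in its interior). -/
def IsDiscAlgebraMultiple (g f : L2) : Prop :=
  ∃ a : ℂ → ℂ, DiffContOnCl ℂ a (Metric.ball 0 1) ∧ ∀ᵐ x ∂arc, f x = a (chi x) * g x

/-- `g ∈ H²` is outer if `{a g : a ∈ A(𝔻)}` is dense in the Hilbert space `H²`. -/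
def IsOuter (g : L2) : Prop :=
  g ∈ H2 ∧ closure {f : L2 | IsDiscAlgebraMultiple g f} = (H2 : Set L2)

/-- The identity `φ |g|² = c χ + (c χ)^*` almost everywhere on the circle. -/
def ModulusIdentity (φ : RealLinf) (g : L2) (c : ℂ) : Prop :=
  ∀ᵐ x ∂arc, ((φ x * ‖g x‖ ^ 2 : ℝ) : ℂ) = c * chi x + conj (c * chi x)

/-- The subspace of `ℂ ⊕ ℂ z` determined by two values `g(0) = w₀` and `g'(0) = w₁`: the orthogonal
complement of `w₀ + w₁ z` in `ℂ ⊕ ℂ z`. -/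
def determinedSpace (w₀ w₁ : ℂ) : Submodule ℂ L2 :=
  affinePolys ⊓ (Submodule.span ℂ {w₀ • fourierLp (T := 1) 2 0 + w₁ • fourierLp (T := 1) 2 1})ᗮ

end NeilToeplitz

end

/-! If `g` is in the kernel, `φ g` is orthogonal to H²_𝒱, which contains `g` and, for every 𝒱, all
of χ²H². Testing against `g` and χⁿ`g`, n ≥ 2, leaves the real function φ|g|² only its coefficients
of index ±1 (`exists_modulusIdentity`).

Outerness comes from Beurling's wandering vector: the component θ of `g` orthogonal to the closed
span of χⁿ`g`, n ≥ 1, has constant modulus, and θ^*`g` is in H². Testing `φ g` against χⁿθ^*`g`, n ≥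
2, yields c θ̂(n-1) + c̄ θ̂(n+1) = 0. This preserves moduli in steps of two, while the coefficients
of an L² function tend to 0; so θ is constant and the invariant subspace generated by `g` is H²
(`isOuter_of_toeplitz_eq_zero`).

Conversely, if `g` is outer, (1) makes `φ g` orthogonal to χ²H² and to `g`, which together span H²_𝒱
for the determined 𝒱. No smaller 𝒱 works, since ⟨χ`g`, `φ g`⟩ = c ≠ 0 (`eq_determinedSpace`).

For two kernel functions, possibly for different spaces, both right sides of (1) have the sign of φ,
so their constants differ by a positive factor. The moduli are then proportional, hence so are the
outer functions (`exists_smul_of_modulusIdentity`), and `g` determines 𝒱. -/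

noncomputable section

namespace NeilToeplitz

open MeasureTheory Filter Topology
open scoped ENNReal ComplexConjugate

/-! ### Fourier uniqueness for integrable functions -/

/-- An integrable function on the circle all of whose Fourier coefficients vanish is zero. -/
theorem ae_eq_zero_of_fourierCoeff_eq_zero {F : UnitAddCircle → ℂ} (hF : Integrable F arc)
    (h : ∀ n, fourierCoeff F n = 0) : F =ᵐ[arc] 0 := by
  have hint : ∀ k : C(UnitAddCircle, ℂ), Integrable (fun x => k x * F x) arc := fun k =>
    hF.bdd_mul (c := ‖k‖) k.continuous.aestronglyMeasurable (.of_forall k.norm_coe_le_norm)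
  have hle : ∀ k : C(UnitAddCircle, ℂ), ‖∫ x, k x * F x ∂arc‖ ≤ (∫ x, ‖F x‖ ∂arc) * ‖k‖ := by
    intro k
    rw [mul_comm, ← integral_const_mul]
    refine (norm_integral_le_integral_norm _).trans
      (integral_mono (hint k).norm (hF.norm.const_mul _) fun x => ?_)
    simp only [norm_mul]
    gcongr
    exact k.norm_coe_le_norm x
  -- Integration against `F` is a bounded functional on continuous functions; it vanishes on the
  -- characters, whose span is dense.
  let L : C(UnitAddCircle, ℂ) →L[ℂ] ℂ := LinearMap.mkContinuous
    { toFun := fun k => ∫ x, k x * F x ∂arc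
      map_add' := fun k l => by
        simp only [ContinuousMap.add_apply, add_mul]
        exact integral_add (hint k) (hint l)
      map_smul' := fun c k => by
        simp only [ContinuousMap.smul_apply, smul_eq_mul, mul_assoc, RingHom.id_apply]
        exact integral_const_mul _ _ } _ hle
  have hL : L = 0 := by
    refine ContinuousLinearMap.ext_on (s := Set.range (fourier (T := 1))) ?_ ?_
    · rw [Submodule.dense_iff_topologicalClosure_eq_top]
      exact span_fourier_closure_eq_top
    · rintro _ ⟨n, rfl⟩
      have := h (-n)
      rw [fourierCoeff, neg_neg] at this
      simpa [L] using this
  have hk : ∀ k : C(UnitAddCircle, ℂ), ∫ x, k x * F x ∂arc = 0 := fun k => DFunLike.congr_fun hL k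
  refine ae_eq_zero_of_forall_setIntegral_isClosed_eq_zero hF fun s hs => ?_
  -- The indicator of a closed set is a pointwise limit of continuous functions bounded by 1.
  have hlim : Tendsto (fun n => ∫ x, ((hs.apprSeq n x : NNReal) : ℂ) * F x ∂arc) atTop
      (𝓝 (∫ x, s.indicator F x ∂arc)) := by
    refine tendsto_integral_of_dominated_convergence (fun x => ‖F x‖) (fun n => ?_) hF.norm
      (fun n => .of_forall fun x => ?_) (.of_forall fun x => ?_)
    · refine AEStronglyMeasurable.mul ?_ hF.1
      exact Continuous.aestronglyMeasurable
        (Complex.continuous_ofReal.comp (NNReal.continuous_coe.comp (hs.apprSeq n).continuous))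
    · rw [norm_mul]
      refine mul_le_of_le_one_left (norm_nonneg _) ?_
      simpa using HasOuterApproxClosed.apprSeq_apply_le_one hs n x
    · have h1 := (tendsto_pi_nhds.1 (HasOuterApproxClosed.tendsto_apprSeq hs)) x
      have h2 : Tendsto (fun n => ((hs.apprSeq n x : NNReal) : ℂ)) atTop
          (𝓝 ((s.indicator (fun _ => (1 : NNReal)) x : NNReal) : ℂ)) :=
        ((Complex.continuous_ofReal.comp NNReal.continuous_coe).tendsto _).comp h1
      have h3 := h2.mul_const (F x)
      by_cases hx : x ∈ s <;> simpa [hx] using h3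
  have h0 : ∀ n, ∫ x, ((hs.apprSeq n x : NNReal) : ℂ) * F x ∂arc = 0 := fun n =>
    hk ⟨fun x => ((hs.apprSeq n x : NNReal) : ℂ),
      Complex.continuous_ofReal.comp (NNReal.continuous_coe.comp (hs.apprSeq n).continuous)⟩
  simp only [h0] at hlim
  rw [← integral_indicator hs.measurableSet]
  exact (tendsto_nhds_unique hlim tendsto_const_nhds)

/-! ### Multiplication operators and shifts on L² -/

/-- Multiplication by a bounded function, as an operator on `L²`. -/
def mulCLM (b : UnitAddCircle → ℂ) (hb : MemLp b ∞ arc) : L2 →L[ℂ] L2 :=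
  LinearMap.mkContinuous
    { toFun := fun f => (hb.toLp b • f : L2)
      map_add' := fun _ _ => Lp.add_smul _ _ _
      map_smul' := fun _ _ => (Lp.smul_comm _ _ _).symm } ‖hb.toLp b‖
    fun _ => Lp.norm_smul_le _ _

theorem coeFn_mulCLM (b : UnitAddCircle → ℂ) (hb : MemLp b ∞ arc) (f : L2) :
    mulCLM b hb f =ᵐ[arc] fun x => b x * f x := by
  have h : mulCLM b hb f =ᵐ[arc] ⇑(hb.toLp b) • ⇑f := Lp.coeFn_lpSMul (r := 2) (hb.toLp b) f
  filter_upwards [h, hb.coeFn_toLp] with x h1 h2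
  rw [h1, Pi.smul_apply', h2, smul_eq_mul]

theorem integrable_conj_mul (f g : L2) : Integrable (fun x => conj (f x) * g x) arc := by
  have := L2.integrable_inner (𝕜 := ℂ) f g
  simpa [RCLike.inner_apply, mul_comm] using this

theorem inner_eq_integral (f g : L2) : inner ℂ f g = ∫ x, conj (f x) * g x ∂arc := by
  rw [L2.inner_def]
  simp [RCLike.inner_apply, mul_comm]

theorem memLp_fourier (n : ℤ) : MemLp (fourier (T := 1) n) ∞ arc :=
  memLp_top_of_bound (fourier n).continuous.aestronglyMeasurable 1
    (.of_forall fun x => ((fourier n).norm_coe_le_norm x).trans (fourier_norm n).le)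

/-- Multiplication by `χⁿ`. -/
def shift (n : ℤ) : L2 →L[ℂ] L2 := mulCLM _ (memLp_fourier n)

theorem coeFn_shift (n : ℤ) (f : L2) : shift n f =ᵐ[arc] fun x => fourier n x * f x :=
  coeFn_mulCLM _ _ f

/-- Translates orthogonality to shifts into vanishing Fourier coefficients of an integrable product.
-/
theorem inner_shift_left (n : ℤ) (f g : L2) :
    inner ℂ (shift n f) g = fourierCoeff (fun x => conj (f x) * g x) n := by
  rw [inner_eq_integral, fourierCoeff]
  refine integral_congr_ae ?_
  filter_upwards [coeFn_shift n f] with x hx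
  rw [hx, fourier_neg, map_mul, smul_eq_mul, mul_assoc]

theorem inner_shift_right (n : ℤ) (f g : L2) :
    inner ℂ f (shift n g) = fourierCoeff (fun x => conj (f x) * g x) (-n) := by
  rw [inner_eq_integral, fourierCoeff]
  refine integral_congr_ae ?_
  filter_upwards [coeFn_shift n g] with x hx
  simp only [hx, neg_neg, smul_eq_mul]
  ring

theorem fourierCoeff_shift (k n : ℤ) (f : L2) :
    fourierCoeff (shift k f) n = fourierCoeff f (n - k) := by
  rw [fourierCoeff, fourierCoeff]
  refine integral_congr_ae ?_
  filter_upwards [coeFn_shift k f] with x hx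
  rw [hx, smul_eq_mul, smul_eq_mul, ← mul_assoc, ← fourier_add]
  congr 3
  ring

theorem shift_shift (m n : ℤ) (f : L2) : shift m (shift n f) = shift (m + n) f := by
  apply Lp.ext
  filter_upwards [coeFn_shift m (shift n f), coeFn_shift n f, coeFn_shift (m + n) f]
    with x h1 h2 h3
  rw [h1, h2, h3, fourier_add, mul_assoc]

theorem shift_zero (f : L2) : shift 0 f = f := by
  apply Lp.ext
  filter_upwards [coeFn_shift 0 f] with x h1
  rw [h1, fourier_zero, one_mul]

theorem shift_fourierLp (m n : ℤ) :
    shift m (fourierLp (T := 1) 2 n) = fourierLp (T := 1) 2 (m + n) := by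
  apply Lp.ext
  filter_upwards [coeFn_shift m (fourierLp (T := 1) 2 n), coeFn_fourierLp (T := 1) 2 n,
    coeFn_fourierLp (T := 1) 2 (m + n)] with x h1 h2 h3
  rw [h1, h2, h3, fourier_add]

theorem fourierCoeff_fourierLp (m n : ℤ) :
    fourierCoeff (fourierLp (T := 1) 2 m) n = if n = m then 1 else 0 := by
  rw [fourierCoeff_congr_ae (coeFn_fourierLp 2 m), fourierCoeff_fourier, Pi.single_apply]

theorem fourierCoeff_add' (f g : L2) (n : ℤ) :
    fourierCoeff (f + g : L2) n = fourierCoeff f n + fourierCoeff g n := by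
  simp only [fourierCoeff_eq_inner, inner_add_right]

theorem fourierCoeff_sub' (f g : L2) (n : ℤ) :
    fourierCoeff (f - g : L2) n = fourierCoeff f n - fourierCoeff g n := by
  simp only [fourierCoeff_eq_inner, inner_sub_right]

theorem fourierCoeff_smul' (c : ℂ) (f : L2) (n : ℤ) :
    fourierCoeff (c • f : L2) n = c * fourierCoeff f n := by
  simp only [fourierCoeff_eq_inner, inner_smul_right]

theorem fourierCoeff_zero' (n : ℤ) : fourierCoeff (0 : L2) n = 0 := by
  rw [fourierCoeff_eq_inner, inner_zero_right]

theorem ext_fourierCoeff {f g : L2} (h : ∀ n, fourierCoeff f n = fourierCoeff g n) : f = g := by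
  refine (fourierBasis (T := 1)).repr.injective (lp.ext (funext fun n => ?_))
  rw [fourierBasis_repr, fourierBasis_repr, h n]

theorem mem_H2 {f : L2} : f ∈ H2 ↔ ∀ n : ℤ, n < 0 → fourierCoeff f n = 0 := Iff.rfl

theorem shift_mem_H2 {f : L2} (hf : f ∈ H2) {n : ℤ} (hn : 0 ≤ n) : shift n f ∈ H2 := fun m hm => by
  rw [fourierCoeff_shift]
  exact hf _ (by lia)

theorem tendsto_fourierCoeff_atTop (f : L2) :
    Tendsto (fun n : ℕ => fourierCoeff f n) atTop (𝓝 0) := by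
  have h := (hasSum_sq_fourierCoeff f).summable.tendsto_cofinite_zero
  have h1 : Tendsto (fun n : ℤ => ‖fourierCoeff f n‖) cofinite (𝓝 0) := by
    simpa using h.sqrt
  exact (tendsto_zero_iff_norm_tendsto_zero.2 h1).comp
    (Nat.cofinite_eq_atTop ▸ (Nat.cast_injective (R := ℤ)).tendsto_cofinite)

/-- A closed subspace containing the monomials `χⁿ`, `n ≥ 0`, contains `H²`. -/
theorem H2_le_of_fourierLp_mem {M : Submodule ℂ L2} (hM : IsClosed (M : Set L2))
    (h : ∀ n : ℕ, fourierLp (T := 1) 2 n ∈ M) : H2 ≤ M := by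
  intro f hf
  refine hM.mem_of_tendsto (hasSum_fourier_series_L2 f) (.of_forall fun s => ?_)
  refine M.sum_mem fun n _ => ?_
  rcases lt_or_ge n 0 with hn | hn
  · rw [hf n hn, zero_smul]
    exact M.zero_mem
  · lift n to ℕ using hn
    exact M.smul_mem _ (h n)

/-! ### Shift-invariant subspaces and wandering vectors -/

/-- The closed span of the functions `χⁿ g`, `n ≥ k`. -/
def shiftSpan (g : L2) (k : ℕ) : Submodule ℂ L2 :=
  (Submodule.span ℂ (Set.range fun n : ℕ => shift (n + k : ℕ) g)).topologicalClosure

theorem isClosed_shiftSpan (g : L2) (k : ℕ) : IsClosed (shiftSpan g k : Set L2) :=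
  Submodule.isClosed_topologicalClosure _

instance completeSpace_shiftSpan (g : L2) (k : ℕ) : CompleteSpace (shiftSpan g k) :=
  (isClosed_shiftSpan g k).completeSpace_coe

theorem shift_mem_shiftSpan (g : L2) {k n : ℕ} (h : k ≤ n) : shift n g ∈ shiftSpan g k := by
  refine Submodule.le_topologicalClosure _ (Submodule.subset_span ⟨n - k, ?_⟩)
  simp only [Nat.sub_add_cancel h]

theorem shiftSpan_le {g : L2} {k : ℕ} {N : Submodule ℂ L2} (hN : IsClosed (N : Set L2))
    (h : ∀ n : ℕ, k ≤ n → shift n g ∈ N) : shiftSpan g k ≤ N := by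
  refine Submodule.topologicalClosure_minimal _ (Submodule.span_le.2 ?_) hN
  rintro _ ⟨n, rfl⟩
  exact h _ (Nat.le_add_left _ _)

theorem self_mem_shiftSpan (g : L2) : g ∈ shiftSpan g 0 := by
  simpa [shift_zero] using shift_mem_shiftSpan g (le_refl 0)

theorem shift_mem_shiftSpan_of_mem {g f : L2} {j : ℕ} (hf : f ∈ shiftSpan g j) (n : ℕ) :
    shift n f ∈ shiftSpan g (n + j) := by
  have h : shiftSpan g j ≤ (shiftSpan g (n + j)).comap (shift n).toLinearMap := by
    refine shiftSpan_le ((isClosed_shiftSpan g (n + j)).preimage (shift n).continuous) fun m hm => ?_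
    rw [Submodule.mem_comap, ContinuousLinearMap.coe_coe, shift_shift]
    exact_mod_cast shift_mem_shiftSpan g (Nat.add_le_add_left hm n)
  exact h hf

theorem shiftSpan_le_H2 {g : L2} (hg : g ∈ H2) (k : ℕ) : shiftSpan g k ≤ H2 :=
  shiftSpan_le isClosed_H2 fun n _ => shift_mem_H2 hg (Int.natCast_nonneg n)

/-- At the index `N` of the first nonzero coefficient of `g`, every χⁿ`g` with n ≥ 1 has coefficient
zero, a closed linear condition that `g` violates. -/
theorem not_mem_shiftSpan_one {g : L2} (hg : g ∈ H2) (hg0 : g ≠ 0) : g ∉ shiftSpan g 1 := by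
  have hex : ∃ n : ℕ, fourierCoeff g n ≠ 0 := by
    by_contra! h
    refine hg0 (ext_fourierCoeff fun n => ?_)
    rw [fourierCoeff_zero']
    rcases lt_or_ge n 0 with hn | hn
    · exact hg n hn
    · lift n to ℕ using hn
      exact h n
  classical
  set N := Nat.find hex with hN
  intro hmem
  have hle : shiftSpan g 1 ≤ (innerSL ℂ (fourierLp (T := 1) 2 (N : ℤ))).ker := by
    refine shiftSpan_le (ContinuousLinearMap.isClosed_ker _) fun n hn => ?_
    rw [LinearMap.mem_ker, ContinuousLinearMap.coe_coe, innerSL_apply_apply,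
      ← fourierCoeff_eq_inner, fourierCoeff_shift]
    rcases lt_or_ge N n with h | h
    · exact hg _ (by lia)
    · have := Nat.find_min hex (m := N - n) (by lia)
      rw [not_not, Nat.cast_sub h] at this
      exact this
  have := hle hmem
  rw [LinearMap.mem_ker, ContinuousLinearMap.coe_coe, innerSL_apply_apply,
      ← fourierCoeff_eq_inner] at this
  exact Nat.find_spec hex this

theorem fourierCoeff_conj (F : UnitAddCircle → ℂ) (n : ℤ) :
    fourierCoeff (fun x => conj (F x)) n = conj (fourierCoeff F (-n)) := by
  rw [fourierCoeff, fourierCoeff, ← integral_conj]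
  refine integral_congr_ae (.of_forall fun x => ?_)
  simp

theorem fourierCoeff_const (a : ℂ) (n : ℤ) :
    fourierCoeff (fun _ : UnitAddCircle => a) n = if n = 0 then a else 0 := by
  have h := fourierCoeff.const_mul (T := 1) (fourier 0) a n
  rw [fourierCoeff_fourier, Pi.single_apply] at h
  simpa using h

/-- The wandering vector of the invariant subspace generated by `g`. -/
theorem exists_wandering {g : L2} (hg : g ∈ H2) (hg0 : g ≠ 0) :
    ∃ θ ∈ shiftSpan g 0, (∀ n : ℕ, 1 ≤ n → inner ℂ θ (shift n g) = 0) ∧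
      ∃ κ : ℝ, 0 < κ ∧ ∀ᵐ x ∂arc, ‖θ x‖ ^ 2 = κ := by
  let P := (shiftSpan g 1).starProjection
  have hP : P g ∈ shiftSpan g 1 := Submodule.starProjection_apply_mem _ _
  have hmono : shiftSpan g 1 ≤ shiftSpan g 0 :=
    shiftSpan_le (isClosed_shiftSpan g 0) fun n _ => shift_mem_shiftSpan g (Nat.zero_le n)
  have hθ : g - P g ∈ shiftSpan g 0 := Submodule.sub_mem _ (self_mem_shiftSpan g) (hmono hP)
  have hperp : ∀ f ∈ shiftSpan g 1, inner ℂ (g - P g) f = 0 := fun f hf =>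
    (Submodule.mem_orthogonal' _ _).1 (Submodule.sub_starProjection_mem_orthogonal g) f hf
  have hne : g - P g ≠ 0 := fun h =>
    not_mem_shiftSpan_one hg hg0 (by rwa [← sub_eq_zero.1 h] at hP)
  generalize g - P g = θ at hθ hperp hne
  refine ⟨θ, hθ, fun n hn => hperp _ (shift_mem_shiftSpan g hn), ‖θ‖ ^ 2, by positivity, ?_⟩
  -- χⁿθ lies in the span of the χᵐ`g` with m ≥ n ≥ 1, to which θ is orthogonal. Conjugation handles
  -- the other sign, so |θ|² has only a constant term.
  have hcoeff : ∀ n : ℕ, 1 ≤ n → fourierCoeff (fun x => conj (θ x) * θ x) (-n : ℤ) = 0 := by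
    intro n hn
    rw [← inner_shift_right]
    refine hperp _ ?_
    have h1 := shift_mem_shiftSpan_of_mem hθ n
    exact shiftSpan_le (isClosed_shiftSpan g 1)
      (fun m hm => shift_mem_shiftSpan g (by lia)) h1
  have hae : (fun x => conj (θ x) * θ x - ((‖θ‖ ^ 2 : ℝ) : ℂ)) =ᵐ[arc] 0 := by
    refine ae_eq_zero_of_fourierCoeff_eq_zero
      ((integrable_conj_mul θ θ).sub (integrable_const _)) fun n => ?_
    have hsub := congrFun (fourierCoeff.add (T := 1) (integrable_conj_mul θ θ)
      (integrable_const (-((‖θ‖ ^ 2 : ℝ) : ℂ)))) n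
    have hfun : (fun x => conj (θ x) * θ x - ((‖θ‖ ^ 2 : ℝ) : ℂ)) =
        (fun x => conj (θ x) * θ x) + fun _ => -((‖θ‖ ^ 2 : ℝ) : ℂ) := by
      ext x
      simp [sub_eq_add_neg]
    rw [hfun, hsub, Pi.add_apply, fourierCoeff_const]
    rcases lt_trichotomy n 0 with h | h | h
    · have := hcoeff n.natAbs (by lia)
      rw [show (-(n.natAbs : ℤ)) = n by lia] at this
      simp [this, h.ne]
    · subst h
      have h0 := inner_shift_left 0 θ θ
      rw [shift_zero, inner_self_eq_norm_sq_to_K] at h0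
      rw [← h0]
      simp
    · have := hcoeff n.natAbs (by lia)
      rw [show (-(n.natAbs : ℤ)) = -n by lia] at this
      have hc := fourierCoeff_conj (fun x => conj (θ x) * θ x) n
      rw [this, map_zero] at hc
      simp only [map_mul, Complex.conj_conj] at hc
      simp only [mul_comm (θ _)] at hc
      simp [hc, h.ne']
  filter_upwards [hae] with x hx
  rw [Pi.zero_apply, sub_eq_zero, mul_comm, Complex.mul_conj, Complex.normSq_eq_norm_sq] at hx
  exact_mod_cast hx

/-- A nonzero function of `H²` is nonzero almost everywhere. -/
theorem ae_ne_zero_of_mem_H2 {g : L2} (hg : g ∈ H2) (hg0 : g ≠ 0) : ∀ᵐ x ∂arc, g x ≠ 0 := by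
  obtain ⟨θ, hθ, -, κ, hκ, hθκ⟩ := exists_wandering hg hg0
  have hZ : MeasurableSet {x : UnitAddCircle | g x = 0} :=
    (Lp.stronglyMeasurable g).measurable (measurableSet_singleton 0)
  have hb : MemLp ({x : UnitAddCircle | g x = 0}.indicator fun _ => (1 : ℂ)) ∞ arc :=
    (memLp_top_const 1).indicator hZ
  -- The indicator of the zero set of `g` annihilates every χⁿ`g`, hence also θ, whose modulus is a
  -- positive constant.
  have hle : shiftSpan g 0 ≤ (mulCLM _ hb).ker := by
    refine shiftSpan_le (ContinuousLinearMap.isClosed_ker _) fun n _ => ?_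
    rw [LinearMap.mem_ker, ContinuousLinearMap.coe_coe]
    apply Lp.ext
    filter_upwards [coeFn_mulCLM _ hb (shift n g), coeFn_shift n g, Lp.coeFn_zero ℂ 2 arc]
      with x h1 h2 h3
    rw [h1, h2, h3]
    by_cases hx : g x = 0 <;> simp [hx]
  have h0 : mulCLM _ hb θ = 0 := hle hθ
  filter_upwards [coeFn_mulCLM _ hb θ, h0 ▸ Lp.coeFn_zero ℂ 2 arc, hθκ] with x h1 h2 h3 hx
  rw [h2] at h1
  have : θ x = 0 := by simpa [hx] using h1.symm
  rw [this] at h3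
  simp at h3
  exact hκ.ne h3

/-! ### Multiplication by disc algebra functions -/

theorem chi_eq_fourier (x : UnitAddCircle) : chi x = fourier 1 x := fourier_one.symm

theorem chi_pow (x : UnitAddCircle) (n : ℕ) : chi x ^ n = fourier (n : ℤ) x := by
  induction n with
  | zero => simp
  | succ n ih => rw [pow_succ, ih, chi_eq_fourier, Nat.cast_succ, fourier_add]

theorem norm_chi (x : UnitAddCircle) : ‖chi x‖ = 1 := Circle.norm_coe _

theorem continuous_chi : Continuous chi := by
  rw [show chi = fourier (T := 1) 1 from funext chi_eq_fourier]
  exact (fourier 1).continuous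

theorem norm_fourier_apply (n : ℤ) (x : UnitAddCircle) : ‖fourier n x‖ = 1 := Circle.norm_coe _

theorem integrable_fourier_mul {g : UnitAddCircle → ℂ} (hg : Integrable g arc) (n : ℤ) :
    Integrable (fun x => fourier n x * g x) arc := hg.fourier_smul n

theorem fourierCoeff_fourier_mul (g : UnitAddCircle → ℂ) (k n : ℤ) :
    fourierCoeff (fun x => fourier k x * g x) n = fourierCoeff g (n - k) := by
  rw [fourierCoeff, fourierCoeff]
  refine integral_congr_ae (.of_forall fun x => ?_)
  simp only [smul_eq_mul]
  rw [← mul_assoc, ← fourier_add]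
  congr 3
  ring

/-- On |z| = r < 1 the power series of `a` converges absolutely, so the integral can be taken term
by term, and each χᵏ`g` has no coefficients below `N`. -/
theorem fourierCoeff_dilation_mul_eq_zero {a : ℂ → ℂ} (ha : DiffContOnCl ℂ a (Metric.ball 0 1))
    {g : UnitAddCircle → ℂ} (hg : Integrable g arc) {N : ℤ}
    (h : ∀ n < N, fourierCoeff g n = 0) {n : ℤ} (hn : n < N) {r : ℝ} (hr0 : 0 ≤ r) (hr : r < 1) :
    fourierCoeff (fun x => a (r * chi x) * g x) n = 0 := by
  have hp := DiffContOnCl.hasFPowerSeriesOnBall (R := 1) (c := 0) (by simpa using ha) one_pos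
  set p := cauchyPowerSeries a 0 (1 : NNReal)
  have hsum : Summable fun k => ‖p.coeff k‖ * r ^ k := by
    lift r to NNReal using hr0
    have := p.summable_norm_mul_pow (r := r) (lt_of_lt_of_le (by exact_mod_cast hr) hp.r_le)
    simpa using this
  have hint := integrable_fourier_mul hg
  let F : ℕ → UnitAddCircle → ℂ := fun k x => (p.coeff k * r ^ k) * (fourier (-(n - k)) x * g x)
  have hFint : ∀ k, Integrable (F k) arc := fun k => (hint _).const_mul _
  have hnorm : ∀ k, ∫ x, ‖F k x‖ ∂arc = ‖p.coeff k‖ * r ^ k * ∫ x, ‖g x‖ ∂arc := by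
    intro k
    rw [← integral_const_mul]
    refine integral_congr_ae (.of_forall fun x => ?_)
    simp only [F, norm_mul, norm_fourier_apply, norm_pow, Complex.norm_real, Real.norm_eq_abs,
      abs_of_nonneg hr0, one_mul]
  have key := hasSum_integral_of_summable_integral_norm hFint
    (by simp only [hnorm]; exact hsum.mul_right _)
  have h0 : ∀ k, ∫ x, F k x ∂arc = 0 := by
    intro k
    have := h (n - k) (by lia)
    rw [fourierCoeff] at this
    simp only [smul_eq_mul] at this
    simp only [F]
    rw [integral_const_mul, this, mul_zero]
  simp only [h0] at key
  rw [fourierCoeff, ← key.unique hasSum_zero]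
  refine integral_congr_ae (.of_forall fun x => ?_)
  have hmem : (r * chi x : ℂ) ∈ Metric.eball (0 : ℂ) ((1 : NNReal) : ℝ≥0∞) := by
    rw [Metric.eball_coe]
    simpa [norm_chi, abs_of_nonneg hr0] using hr
  have hs := hp.hasSum hmem
  rw [zero_add] at hs
  have hs2 := (hs.mul_right (fourier (-n) x * g x)).tsum_eq
  simp only [smul_eq_mul]
  rw [mul_left_comm, ← hs2]
  refine tsum_congr fun k => ?_
  rw [p.apply_eq_pow_smul_coeff, smul_eq_mul, mul_pow, chi_pow,
    show F k x = p.coeff k * r ^ k * (fourier (-(n - k)) x * g x) from rfl,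
    show -(n - (k : ℤ)) = k + -n by ring, fourier_add]
  ring

/-- Multiplication by a function of the disc algebra does not create Fourier coefficients of low
index. -/
theorem fourierCoeff_discAlgebra_mul_eq_zero {a : ℂ → ℂ}
    (ha : DiffContOnCl ℂ a (Metric.ball 0 1)) {g : UnitAddCircle → ℂ} (hg : Integrable g arc)
    {N : ℤ} (h : ∀ n < N, fourierCoeff g n = 0) {n : ℤ} (hn : n < N) :
    fourierCoeff (fun x => a (chi x) * g x) n = 0 := by
  have hcont : ContinuousOn a (Metric.closedBall 0 1) := by
    simpa [closure_ball] using ha.continuousOn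
  obtain ⟨C, hC⟩ := (isCompact_closedBall (0 : ℂ) 1).exists_bound_of_continuousOn hcont
  let r : ℕ → ℝ := fun j => 1 - 1 / (j + 1)
  have hr1 : ∀ j, r j < 1 := fun j => by
    have : (0 : ℝ) < 1 / (j + 1) := by positivity
    simp only [r]
    linarith
  have hr0 : ∀ j, 0 ≤ r j := fun j => by
    have : 1 / ((j : ℝ) + 1) ≤ 1 := by
      rw [div_le_one (by positivity)]
      linarith [Nat.cast_nonneg (α := ℝ) j]
    simp only [r]
    linarith
  have hrlim : Tendsto r atTop (𝓝 1) := by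
    have := (tendsto_one_div_add_atTop_nhds_zero_nat (𝕜 := ℝ)).const_sub 1
    simpa [r] using this
  have hmem : ∀ j x, (r j * chi x : ℂ) ∈ Metric.closedBall (0 : ℂ) 1 := fun j x => by
    simpa [norm_chi, abs_of_nonneg (hr0 j)] using (hr1 j).le
  -- Dominated convergence as r → 1: `a` is continuous and bounded on the closed disc.
  have hlim : Tendsto (fun j => fourierCoeff (fun x => a (r j * chi x) * g x) n) atTop
      (𝓝 (fourierCoeff (fun x => a (chi x) * g x) n)) := by
    refine tendsto_integral_of_dominated_convergence (fun x => C * ‖g x‖) (fun j => ?_)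
      (hg.norm.const_mul C) (fun j => .of_forall fun x => ?_) (.of_forall fun x => ?_)
    · refine (fourier (-n)).continuous.aestronglyMeasurable.smul (AEStronglyMeasurable.mul ?_ hg.1)
      exact (hcont.comp_continuous (continuous_const.mul continuous_chi)
        (hmem j)).aestronglyMeasurable
    · rw [norm_smul, norm_fourier_apply, one_mul, norm_mul]
      gcongr
      exact hC _ (hmem j x)
    · refine Tendsto.const_smul (Tendsto.mul_const _ ?_) _
      have hx : chi x ∈ Metric.closedBall (0 : ℂ) 1 := by simp [norm_chi]
      refine (hcont _ hx).tendsto.comp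
        (tendsto_nhdsWithin_iff.2 ⟨?_, .of_forall fun j => hmem j x⟩)
      have := ((Complex.continuous_ofReal.tendsto 1).comp hrlim).mul_const (chi x)
      simpa using this
  refine tendsto_nhds_unique hlim ?_
  simp only [fourierCoeff_dilation_mul_eq_zero ha hg h hn (hr0 _) (hr1 _)]
  exact tendsto_const_nhds

theorem integrable_coe (f : L2) : Integrable f arc :=
  (Lp.memLp f).integrable (by norm_num)

theorem IsDiscAlgebraMultiple.fourierCoeff_eq_zero {f g : L2} (hf : IsDiscAlgebraMultiple g f)
    {N : ℤ} (h : ∀ n < N, fourierCoeff g n = 0) {n : ℤ} (hn : n < N) : fourierCoeff f n = 0 := by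
  obtain ⟨a, ha, hfa⟩ := hf
  rw [fourierCoeff_congr_ae hfa]
  exact fourierCoeff_discAlgebra_mul_eq_zero ha (integrable_coe g) h hn

theorem IsDiscAlgebraMultiple.mem_H2 {f g : L2} (hf : IsDiscAlgebraMultiple g f) (hg : g ∈ H2) :
    f ∈ H2 := fun _ hn => hf.fourierCoeff_eq_zero hg hn

/-! ### Outer functions and their values at the origin -/

/-- The functions `a g` with `a` in the disc algebra, as a subspace. -/
def discAlgebraMultiples (g : L2) : Submodule ℂ L2 where
  carrier := {f | IsDiscAlgebraMultiple g f}
  zero_mem' := ⟨fun _ => 0, diffContOnCl_const, by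
    filter_upwards [Lp.coeFn_zero ℂ 2 arc] with x hx
    rw [hx, zero_mul, Pi.zero_apply]⟩
  add_mem' := by
    rintro f₁ f₂ ⟨a, ha, h1⟩ ⟨b, hb, h2⟩
    refine ⟨a + b, ha.add hb, ?_⟩
    filter_upwards [h1, h2, Lp.coeFn_add f₁ f₂] with x h1 h2 h3
    rw [h3, Pi.add_apply, Pi.add_apply, h1, h2, add_mul]
  smul_mem' := by
    rintro c f ⟨a, ha, h1⟩
    refine ⟨c • a, ha.const_smul c, ?_⟩
    filter_upwards [h1, Lp.coeFn_smul c f] with x h1 h3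
    rw [h3, Pi.smul_apply, Pi.smul_apply, h1, smul_mul_assoc]

theorem isOuter_of_H2_le {g : L2} (hg : g ∈ H2) (h : H2 ≤ shiftSpan g 0) : IsOuter g := by
  refine ⟨hg, Set.Subset.antisymm (closure_minimal (fun f hf => hf.mem_H2 hg) isClosed_H2) ?_⟩
  intro f hf
  have hle : shiftSpan g 0 ≤ (discAlgebraMultiples g).topologicalClosure := by
    refine shiftSpan_le (Submodule.isClosed_topologicalClosure _) fun n _ =>
      Submodule.le_topologicalClosure _ ⟨fun z => z ^ n, ?_, ?_⟩
    · exact (differentiable_id.pow n).diffContOnCl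
    · filter_upwards [coeFn_shift n g] with x hx
      rw [hx, chi_pow]
  exact hle (h hf)

theorem IsOuter.H2_le {g : L2} (hg : IsOuter g) {M : Submodule ℂ L2}
    (hM : IsClosed (M : Set L2)) (h : ∀ f, IsDiscAlgebraMultiple g f → f ∈ M) : H2 ≤ M := by
  intro f hf
  have : f ∈ closure {f : L2 | IsDiscAlgebraMultiple g f} := hg.2 ▸ hf
  exact closure_minimal h hM this

theorem fourierLp_mem_H2 {n : ℤ} (hn : 0 ≤ n) : fourierLp (T := 1) 2 n ∈ H2 := fun m hm => by
  rw [fourierCoeff_fourierLp, if_neg (by lia)]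

/-- Otherwise all multiples `a g`, and by density all of H², would vanish at 0; the constant 1 does
not. -/
theorem IsOuter.fourierCoeff_zero_ne {g : L2} (hg : IsOuter g) : fourierCoeff g 0 ≠ 0 := by
  intro h0
  have hle : H2 ≤ (innerSL ℂ (fourierLp (T := 1) 2 0)).ker := by
    refine hg.H2_le (ContinuousLinearMap.isClosed_ker _) fun f hf => ?_
    rw [LinearMap.mem_ker, ContinuousLinearMap.coe_coe, innerSL_apply_apply,
      ← fourierCoeff_eq_inner]
    refine hf.fourierCoeff_eq_zero (N := 1) (fun n hn => ?_) one_pos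
    rcases (show n < 0 ∨ n = 0 by lia) with h | rfl
    · exact hg.1 n h
    · exact h0
  have := hle (fourierLp_mem_H2 le_rfl)
  rw [LinearMap.mem_ker, ContinuousLinearMap.coe_coe, innerSL_apply_apply,
      ← fourierCoeff_eq_inner, fourierCoeff_fourierLp, if_pos rfl] at this
  exact one_ne_zero this

theorem IsOuter.ne_zero {g : L2} (hg : IsOuter g) : g ≠ 0 := by
  rintro rfl
  exact hg.fourierCoeff_zero_ne (fourierCoeff_zero' 0)

theorem toDisc_zero (g : L2) : toDisc g 0 = fourierCoeff g 0 := by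
  rw [toDisc, tsum_eq_single 0 fun n hn => by simp [hn]]
  simp

theorem norm_fourierCoeff_le (g : L2) (n : ℤ) : ‖fourierCoeff g n‖ ≤ ‖g‖ := by
  rw [fourierCoeff_eq_inner]
  refine (norm_inner_le_norm _ _).trans ?_
  rw [orthonormal_fourier.1 n, one_mul]

theorem deriv_toDisc_zero (g : L2) : deriv (toDisc g) 0 = fourierCoeff g 1 := by
  let c : ℕ → ℂ := fun n => fourierCoeff g n
  let p := FormalMultilinearSeries.ofScalars ℂ c
  have hrad : 0 < p.radius := by
    refine lt_of_lt_of_le (by simp) (p.le_radius_of_bound (r := 1) ‖g‖ fun n => ?_)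
    rw [FormalMultilinearSeries.ofScalars_norm]
    simpa using norm_fourierCoeff_le g n
  have hsum : p.sum = toDisc g := by
    ext z
    change FormalMultilinearSeries.ofScalarsSum c z = _
    rw [FormalMultilinearSeries.ofScalars_sum_eq, toDisc]
    simp [c]
  have h := (p.hasFPowerSeriesOnBall hrad).hasFPowerSeriesAt.deriv
  rw [hsum] at h
  rw [h, FormalMultilinearSeries.ofScalars_apply_eq]
  simp [c]

/-! ### The trigonometric polynomials cχ + (cχ)^* -/

theorem conj_chi_mul (c : ℂ) (x : UnitAddCircle) :
    conj (c * chi x) = conj c * fourier (-1) x := by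
  rw [map_mul, chi_eq_fourier, fourier_neg]

theorem fourierCoeff_band_mul (c : ℂ) {G : UnitAddCircle → ℂ} (hG : Integrable G arc) (n : ℤ) :
    fourierCoeff (fun x => (c * chi x + conj (c * chi x)) * G x) n =
      c * fourierCoeff G (n - 1) + conj c * fourierCoeff G (n + 1) := by
  have h := congrFun (fourierCoeff.add (T := 1)
    ((integrable_fourier_mul hG 1).const_mul c)
    ((integrable_fourier_mul hG (-1)).const_mul (conj c))) n
  rw [Pi.add_apply, fourierCoeff.const_mul, fourierCoeff.const_mul, fourierCoeff_fourier_mul,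
    fourierCoeff_fourier_mul, sub_neg_eq_add] at h
  rw [← h]
  congr 1
  ext x
  rw [conj_chi_mul, chi_eq_fourier, Pi.add_apply]
  ring

theorem fourierCoeff_band (c : ℂ) (n : ℤ) :
    fourierCoeff (fun x => c * chi x + conj (c * chi x)) n =
      c * (if n = 1 then 1 else 0) + conj c * (if n = -1 then 1 else 0) := by
  have h := fourierCoeff_band_mul c (integrable_const (1 : ℂ)) n
  simpa only [mul_one, fourierCoeff_const, sub_eq_zero, add_eq_zero_iff_eq_neg] using h

theorem integrable_band (c : ℂ) : Integrable (fun x => c * chi x + conj (c * chi x)) arc := by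
  have h : Continuous fun x => c * chi x := continuous_const.mul continuous_chi
  refine Integrable.of_bound (h.add (Complex.continuous_conj.comp h)).aestronglyMeasurable
    (‖c‖ + ‖c‖) (.of_forall fun x => ?_)
  refine (norm_add_le _ _).trans ?_
  simp [norm_chi]

/-- A real integrable function whose Fourier coefficients of index `0` and `n ≥ 2` vanish is
`c χ + (c χ)^*`. -/
theorem exists_eq_band {F : UnitAddCircle → ℝ} (hF : Integrable F arc)
    (h0 : fourierCoeff (fun x => (F x : ℂ)) 0 = 0)
    (h2 : ∀ n : ℕ, 2 ≤ n → fourierCoeff (fun x => (F x : ℂ)) n = 0) :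
    ∃ c : ℂ, ∀ᵐ x ∂arc, (F x : ℂ) = c * chi x + conj (c * chi x) := by
  have hsymm : ∀ n, fourierCoeff (fun x => (F x : ℂ)) n =
      conj (fourierCoeff (fun x => (F x : ℂ)) (-n)) := fun n => by
    rw [← fourierCoeff_conj]
    simp only [Complex.conj_ofReal]
  set c := fourierCoeff (fun x => (F x : ℂ)) 1 with hc
  refine ⟨c, ?_⟩
  have hae : (fun x => (F x : ℂ) - (c * chi x + conj (c * chi x))) =ᵐ[arc] 0 := by
    refine ae_eq_zero_of_fourierCoeff_eq_zero (hF.ofReal.sub (integrable_band c)) fun n => ?_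
    have hsub : fourierCoeff (fun x => (F x : ℂ) - (c * chi x + conj (c * chi x))) n =
        fourierCoeff (fun x => (F x : ℂ)) n
          - fourierCoeff (fun x => c * chi x + conj (c * chi x)) n := by
      simp only [fourierCoeff, smul_sub]
      exact integral_sub (hF.ofReal.fourier_smul _) ((integrable_band c).fourier_smul _)
    rw [hsub, fourierCoeff_band]
    rcases (show n = 0 ∨ n = 1 ∨ n = -1 ∨ 2 ≤ n ∨ n ≤ -2 by lia) with rfl | rfl | rfl | h | h
    · simp [h0]
    · simp [← hc]
    · rw [hsymm, neg_neg, ← hc]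
      simp
    · lift n to ℕ using by lia
      rw [h2 n (by lia)]
      simp [show (n : ℤ) ≠ 1 by lia, show (n : ℤ) ≠ -1 by lia]
    · obtain ⟨m, rfl⟩ : ∃ m : ℕ, n = -m := ⟨n.natAbs, by lia⟩
      rw [hsymm, neg_neg, h2 m (by lia)]
      simp [show -(m : ℤ) ≠ 1 by lia, show (m : ℤ) ≠ 1 by lia]
  filter_upwards [hae] with x hx
  exact sub_eq_zero.1 hx

/-! ### Kernel functions: modulus identity and outerness -/

theorem coeFn_symbol_smul (φ : RealLinf) (f : L2) :
    (φ • f : L2) =ᵐ[arc] fun x => (φ x : ℂ) * f x := by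
  filter_upwards [Lp.coeFn_lpSMul (r := 2) φ f] with x hx
  rw [hx, Pi.smul_apply', Complex.real_smul]

theorem conj_mul_symbol_smul (φ : RealLinf) (g : L2) :
    (fun x => conj (g x) * (φ • g : L2) x) =ᵐ[arc]
      fun x => ((φ x * ‖g x‖ ^ 2 : ℝ) : ℂ) := by
  filter_upwards [coeFn_symbol_smul φ g] with x hx
  rw [hx, mul_left_comm, mul_comm (conj _), Complex.mul_conj, Complex.normSq_eq_norm_sq]
  push_cast
  rfl

theorem symbol_eq_zero_of_ae {φ : RealLinf} (h : ∀ᵐ x ∂arc, φ x = 0) : φ = 0 := by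
  apply Lp.ext
  filter_upwards [h, Lp.coeFn_zero ℝ ∞ arc] with x h1 h2
  rw [h1, h2, Pi.zero_apply]

theorem ModulusIdentity.ne_zero {φ : RealLinf} (hφ : φ ≠ 0) {g : L2} (hg : g ∈ H2) (hg0 : g ≠ 0)
    {c : ℂ} (h : ModulusIdentity φ g c) : c ≠ 0 := by
  rintro rfl
  refine hφ (symbol_eq_zero_of_ae ?_)
  filter_upwards [h, ae_ne_zero_of_mem_H2 hg hg0] with x h1 h2
  simpa [h2] using h1

theorem toeplitz_eq_zero_iff {φ : RealLinf} {V : Submodule ℂ L2} {f : H2V V} :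
    toeplitz φ V f = 0 ↔ ∀ k ∈ H2V V, inner ℂ k (φ • (f : L2) : L2) = 0 := by
  change (H2V V).orthogonalProjectionOnto (φ • (f : L2) : L2) = 0 ↔ _
  rw [Submodule.orthogonalProjectionOnto_eq_zero_iff, Submodule.mem_orthogonal]

theorem mem_H2V {V : Submodule ℂ L2} {f : L2} :
    f ∈ H2V V ↔ f ∈ H2 ∧ ∀ v ∈ V, inner ℂ v f = 0 := by
  rw [H2V, Submodule.mem_inf, Submodule.mem_orthogonal]

theorem mem_affinePolys {v : L2} : v ∈ affinePolys ↔
    ∃ a b : ℂ, a • fourierLp (T := 1) 2 0 + b • fourierLp (T := 1) 2 1 = v :=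
  Submodule.mem_span_pair

theorem inner_affine (a b : ℂ) (f : L2) :
    inner ℂ (a • fourierLp (T := 1) 2 0 + b • fourierLp (T := 1) 2 1) f =
      conj a * fourierCoeff f 0 + conj b * fourierCoeff f 1 := by
  rw [inner_add_left, inner_smul_left, inner_smul_left, ← fourierCoeff_eq_inner,
    ← fourierCoeff_eq_inner]

/-- χ²H² is orthogonal to 1 and z, so it supplies test functions valid for every 𝒱. -/
theorem shift_mem_H2V {V : Submodule ℂ L2} (hV : V ≤ affinePolys) {f : L2} (hf : f ∈ H2) {n : ℤ}
    (hn : 2 ≤ n) : shift n f ∈ H2V V := by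
  refine mem_H2V.2 ⟨shift_mem_H2 hf (by lia), fun v hv => ?_⟩
  obtain ⟨a, b, rfl⟩ := mem_affinePolys.1 (hV hv)
  rw [inner_affine, fourierCoeff_shift, fourierCoeff_shift, hf _ (by lia), hf _ (by lia)]
  simp

theorem exists_modulusIdentity {φ : RealLinf} {V : Submodule ℂ L2} (hV : V ≤ affinePolys)
    {g : H2V V} (hT : toeplitz φ V g = 0) : ∃ c, ModulusIdentity φ (g : L2) c := by
  have hker := toeplitz_eq_zero_iff.1 hT
  have hg := (mem_H2V.1 g.2).1
  have hcoeff := congrFun (fourierCoeff_congr_ae (conj_mul_symbol_smul φ (g : L2)))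
  refine exists_eq_band (F := fun x => φ x * ‖(g : L2) x‖ ^ 2) ?_ ?_ fun n hn => ?_
  · have h1 := (integrable_conj_mul (g : L2) (φ • (g : L2))).congr (conj_mul_symbol_smul φ (g : L2))
    refine h1.re.congr (.of_forall fun x => ?_)
    exact Complex.ofReal_re _
  · rw [← hcoeff, ← inner_shift_left, shift_zero]
    exact hker _ g.2
  · rw [← hcoeff, ← inner_shift_left]
    exact hker _ (shift_mem_H2V hV hg (by lia))

theorem fourierCoeff_eq_zero_of_recurrence {f : L2} {c : ℂ} (hc : c ≠ 0)
    (h : ∀ n : ℤ, 2 ≤ n → c * fourierCoeff f (n - 1) + conj c * fourierCoeff f (n + 1) = 0)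
    {n : ℤ} (hn : 1 ≤ n) : fourierCoeff f n = 0 := by
  -- The factors c and c̄ have the same modulus and cancel.
  have hstep : ∀ m : ℤ, 1 ≤ m → ‖fourierCoeff f (m + 2)‖ = ‖fourierCoeff f m‖ := by
    intro m hm
    have h1 := congrArg norm (eq_neg_of_add_eq_zero_left (h (m + 1) (by lia)))
    rw [norm_neg, norm_mul, norm_mul, RCLike.norm_conj, add_sub_cancel_right, add_assoc] at h1
    exact (mul_left_cancel₀ (norm_ne_zero_iff.2 hc) h1).symm
  lift n to ℕ using by lia
  have hiter : ∀ k : ℕ, ‖fourierCoeff f ((n + 2 * k : ℕ) : ℤ)‖ = ‖fourierCoeff f n‖ := by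
    intro k
    induction k with
    | zero => simp
    | succ k ih =>
      rw [← ih, ← hstep (n + 2 * k : ℕ) (by lia)]
      congr 2
  have hlim := (tendsto_fourierCoeff_atTop f).norm.comp
    (tendsto_atTop_mono (f := fun k : ℕ => k) (g := fun k : ℕ => n + 2 * k)
      (fun k => by lia) tendsto_id)
  simp only [Function.comp_def, hiter, norm_zero] at hlim
  exact norm_eq_zero.1 (tendsto_nhds_unique tendsto_const_nhds hlim)

/-- The wandering vector of a kernel function is constant, hence kernel functions are outer. -/
theorem isOuter_of_toeplitz_eq_zero {φ : RealLinf} (hφ : φ ≠ 0) {V : Submodule ℂ L2}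
    (hV : V ≤ affinePolys) {g : H2V V} (hg0 : g ≠ 0) (hT : toeplitz φ V g = 0) :
    IsOuter (g : L2) := by
  have hker := toeplitz_eq_zero_iff.1 hT
  obtain ⟨c, hid⟩ := exists_modulusIdentity hV hT
  have hg := (mem_H2V.1 g.2).1
  have hg0' : (g : L2) ≠ 0 := fun h => hg0 (Subtype.ext h)
  generalize (g : L2) = g at hker hid hg hg0'
  have hc := hid.ne_zero hφ hg hg0'
  obtain ⟨θ, hθ, hperp, κ, hκ, hθκ⟩ := exists_wandering hg hg0'
  have hb : MemLp (fun x => conj (θ x)) ∞ arc := by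
    refine memLp_top_of_bound
      (Complex.continuous_conj.comp_aestronglyMeasurable (Lp.aestronglyMeasurable θ)) (√κ) ?_
    filter_upwards [hθκ] with x hx
    rw [RCLike.norm_conj, ← hx, Real.sqrt_sq (norm_nonneg _)]
  set h := mulCLM _ hb g with hh
  -- The negative coefficients of θ^*`g` are the inner products of θ with χᵐ`g`, m ≥ 1.
  have hh2 : h ∈ H2 := fun n hn => by
    obtain ⟨m, rfl⟩ : ∃ m : ℕ, n = -m := ⟨n.natAbs, by lia⟩
    rw [fourierCoeff_congr_ae (coeFn_mulCLM _ hb g), ← inner_shift_right]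
    exact hperp m (by lia)
  -- ⟨χⁿ`h`, `φ g`⟩ is the n-th coefficient of θφ|g|² = θ(cχ + (cχ)^*).
  have hrec : ∀ n : ℤ, 2 ≤ n → c * fourierCoeff θ (n - 1) + conj c * fourierCoeff θ (n + 1) = 0 := by
    intro n hn
    rw [← fourierCoeff_band_mul c (integrable_coe θ), ← hker _ (shift_mem_H2V hV hh2 hn),
      inner_shift_left]
    refine congrFun (fourierCoeff_congr_ae ?_) n
    filter_upwards [hid, coeFn_mulCLM _ hb g, conj_mul_symbol_smul φ g] with x h1 h2 h3
    rw [← h1, ← h3, hh, h2, map_mul, Complex.conj_conj]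
    ring
  have hθc : θ = fourierCoeff θ 0 • fourierLp (T := 1) 2 0 := by
    refine ext_fourierCoeff fun n => ?_
    rw [fourierCoeff_smul', fourierCoeff_fourierLp]
    rcases lt_trichotomy n 0 with h | rfl | h
    · simp [shiftSpan_le_H2 hg 0 hθ n h, h.ne]
    · simp
    · simp [fourierCoeff_eq_zero_of_recurrence hc hrec h, h.ne']
  have hθ0 : fourierCoeff θ 0 ≠ 0 := by
    intro h0
    rw [h0, zero_smul] at hθc
    have hfalse : ∀ᵐ _ ∂arc, False := by
      filter_upwards [hθκ, hθc ▸ Lp.coeFn_zero ℂ 2 arc] with x h1 h2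
      rw [h2] at h1
      simp at h1
      exact hκ.ne h1
    exact IsProbabilityMeasure.ne_zero arc (by simpa using hfalse)
  have he0 : fourierLp (T := 1) 2 0 ∈ shiftSpan g 0 := by
    rw [hθc] at hθ
    exact (Submodule.smul_mem_iff _ hθ0).1 hθ
  refine isOuter_of_H2_le hg (H2_le_of_fourierLp_mem (isClosed_shiftSpan g 0) fun n => ?_)
  have h1 := shift_mem_shiftSpan_of_mem he0 n
  rw [shift_fourierLp, add_zero] at h1
  exact shiftSpan_le (isClosed_shiftSpan g 0)
    (fun m _ => shift_mem_shiftSpan g (Nat.zero_le m)) h1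

/-! ### The space determined by an outer function -/

theorem affine_mem_determinedSpace {w₀ w₁ a b : ℂ} :
    a • fourierLp (T := 1) 2 0 + b • fourierLp (T := 1) 2 1 ∈ determinedSpace w₀ w₁ ↔
      conj w₀ * a + conj w₁ * b = 0 := by
  rw [determinedSpace, Submodule.mem_inf, Submodule.mem_orthogonal_singleton_iff_inner_right,
    inner_affine, and_iff_right (mem_affinePolys.2 ⟨a, b, rfl⟩)]
  simp only [fourierCoeff_add', fourierCoeff_smul', fourierCoeff_fourierLp]
  simp

/-- Orthogonality to a polynomial of degree at most one sees only ĝ(0) and ĝ(1). Thus the determined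
space is the largest admissible 𝒱. -/
theorem le_determinedSpace_iff {V : Submodule ℂ L2} (hV : V ≤ affinePolys) {g : L2}
    (hg : g ∈ H2) :
    V ≤ determinedSpace (fourierCoeff g 0) (fourierCoeff g 1) ↔ g ∈ H2V V := by
  rw [mem_H2V, and_iff_right hg]
  refine forall₂_congr fun v hv => ?_
  obtain ⟨a, b, rfl⟩ := mem_affinePolys.1 (hV hv)
  rw [affine_mem_determinedSpace, inner_affine, ← map_eq_zero (starRingEnd ℂ)]
  simp [mul_comm]

theorem determinedSpace_le (w₀ w₁ : ℂ) : determinedSpace w₀ w₁ ≤ affinePolys := inf_le_left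

/-- If `g` is outer and `φ |g|² = c χ + (c χ)^*`, then `φ g` is orthogonal to `χ² H²`. -/
theorem ModulusIdentity.inner_shift_two_eq_zero {φ : RealLinf} {g : L2} {c : ℂ}
    (h : ModulusIdentity φ g c) (hg : IsOuter g) {m : L2} (hm : m ∈ H2) :
    inner ℂ (φ • g : L2) (shift 2 m) = 0 := by
  have hle : H2 ≤ ((innerSL ℂ (φ • g : L2)).comp (shift 2)).ker := by
    refine hg.H2_le (ContinuousLinearMap.isClosed_ker _) ?_
    rintro f ⟨a, ha, hf⟩
    rw [LinearMap.mem_ker, ContinuousLinearMap.coe_coe, ContinuousLinearMap.comp_apply,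
      innerSL_apply_apply, inner_shift_right]
    -- For f = `a g`, the product (`φ g`)^*f is a(cχ + (cχ)^*), with coefficients starting at index
    -- -1; the one needed has index -2.
    rw [← fourierCoeff_discAlgebra_mul_eq_zero ha (integrable_band c) (N := -1)
      (fun n hn => by
        rw [fourierCoeff_band]
        simp [show n ≠ 1 by lia, show n ≠ -1 by lia]) (show (-2 : ℤ) < -1 by norm_num)]
    refine congrFun (fourierCoeff_congr_ae ?_) _
    filter_upwards [hf, h, conj_mul_symbol_smul φ g] with x h1 h2 h3
    rw [← h2]
    have h4 := congrArg conj h3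
    rw [Complex.conj_ofReal, map_mul, Complex.conj_conj] at h4
    rw [← h4, h1]
    ring
  exact hle hm

theorem ModulusIdentity.inner_shift_symbol_smul {φ : RealLinf} {g : L2} {c : ℂ}
    (h : ModulusIdentity φ g c) (n : ℤ) :
    inner ℂ (shift n g) (φ • g : L2) =
      c * (if n = 1 then 1 else 0) + conj c * (if n = -1 then 1 else 0) := by
  rw [inner_shift_left, ← fourierCoeff_band]
  refine congrFun (fourierCoeff_congr_ae ?_) _
  filter_upwards [h, conj_mul_symbol_smul φ g] with x h2 h3
  rw [h3, h2]

theorem exists_mem_H2V_and_toeplitz_eq_zero {φ : RealLinf} {g : L2} {c : ℂ}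
    (hg : IsOuter g) (h : ModulusIdentity φ g c) :
    ∃ hg : g ∈ H2V (determinedSpace (fourierCoeff g 0) (fourierCoeff g 1)),
      toeplitz φ (determinedSpace (fourierCoeff g 0) (fourierCoeff g 1)) ⟨g, hg⟩ = 0 := by
  refine ⟨(le_determinedSpace_iff (determinedSpace_le _ _) hg.1).1 le_rfl,
    toeplitz_eq_zero_iff.2 fun k hk => ?_⟩
  have h0 := hg.fourierCoeff_zero_ne
  obtain ⟨hk2, hkV⟩ := mem_H2V.1 hk
  -- This vector spans the determined space. Orthogonality to it makes (k̂(0), k̂(1)) proportional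
  -- to (ĝ(0), ĝ(1)), so `k - r • g` is divisible by χ².
  have hrel := hkV _ (affine_mem_determinedSpace (a := conj (fourierCoeff g 1))
    (b := -conj (fourierCoeff g 0)).2 (by ring))
  rw [inner_affine] at hrel
  simp only [map_neg, Complex.conj_conj] at hrel
  set r := fourierCoeff k 0 / fourierCoeff g 0 with hr
  have hm : shift (-2) (k - r • g) ∈ H2 := fun n hn => by
    rw [fourierCoeff_shift, fourierCoeff_sub', fourierCoeff_smul']
    rcases (show n - -2 < 0 ∨ n - -2 = 0 ∨ n - -2 = 1 by lia) with h1 | h1 | h1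
    · rw [hk2 _ h1, hg.1 _ h1]
      ring
    · rw [h1, hr]
      field_simp
      ring
    · rw [h1, hr]
      field_simp
      linear_combination -hrel
  have hsplit : k = shift 2 (shift (-2) (k - r • g)) + r • g := by
    rw [shift_shift, add_neg_cancel, shift_zero, sub_add_cancel]
  rw [hsplit, inner_add_left, inner_smul_left, ← inner_conj_symm,
    h.inner_shift_two_eq_zero hg hm]
  have := h.inner_shift_symbol_smul 0
  rw [shift_zero] at this
  simp [this]

/-- As ĝ(0) ≠ 0, the determined space is a line, so only 𝒱 = 0 has to be excluded. -/
theorem eq_determinedSpace {φ : RealLinf} (hφ : φ ≠ 0) {g : L2} {c : ℂ}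
    (hg : IsOuter g) (h : ModulusIdentity φ g c) {V : Submodule ℂ L2} (hV : V ≤ affinePolys)
    (hgV : g ∈ H2V V) (hT : toeplitz φ V ⟨g, hgV⟩ = 0) :
    V = determinedSpace (fourierCoeff g 0) (fourierCoeff g 1) := by
  have hle := (le_determinedSpace_iff hV hg.1).2 hgV
  have h0 : conj (fourierCoeff g 0) ≠ 0 := (map_ne_zero _).2 hg.fourierCoeff_zero_ne
  refine le_antisymm hle fun w hw => ?_
  by_cases hbot : V = ⊥
  · exfalso
    refine h.ne_zero hφ hg.1 hg.ne_zero ?_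
    -- For 𝒱 = 0 the function χ`g` is an admissible test function, and its pairing with `φ g` is c.
    have h1 := h.inner_shift_symbol_smul 1
    rw [toeplitz_eq_zero_iff.1 hT _ (mem_H2V.2 ⟨shift_mem_H2 hg.1 zero_le_one, fun v hv => ?_⟩)] at h1
    · simpa using h1.symm
    · rw [hbot, Submodule.mem_bot] at hv
      rw [hv, inner_zero_left]
  · obtain ⟨v, hv, hv0⟩ := V.ne_bot_iff.1 hbot
    obtain ⟨a, b, rfl⟩ := mem_affinePolys.1 (hV hv)
    obtain ⟨a', b', rfl⟩ := mem_affinePolys.1 (determinedSpace_le _ _ hw)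
    have e1 := affine_mem_determinedSpace.1 (hle hv)
    have e2 := affine_mem_determinedSpace.1 hw
    have hb : b ≠ 0 := by
      rintro rfl
      have ha : a = 0 := by simpa [h0] using e1
      exact hv0 (by simp [ha])
    have ha' : a' = b' / b * a := by
      have : conj (fourierCoeff g 0) * (a' * b - b' * a) = 0 := by
        linear_combination b * e2 - b' * e1
      rw [mul_eq_zero, or_iff_right h0] at this
      field_simp
      linear_combination this
    have hb' : b' / b * b = b' := div_mul_cancel₀ _ hb
    have hmem := V.smul_mem (b' / b) hv
    rwa [smul_add, smul_smul, smul_smul, ← ha', hb'] at hmem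

/-! ### Uniqueness of kernel functions up to scalars -/

theorem exists_pos_mul_of_re_mul_re_nonneg {c d : ℂ} (hc : c ≠ 0) (hd : d ≠ 0)
    (h : ∀ x : UnitAddCircle, 0 ≤ (c * chi x).re * (d * chi x).re) :
    ∃ t : ℝ, 0 < t ∧ d = t * c := by
  -- By homogeneity the inequality extends from the circle to the plane.
  have hall : ∀ w : ℂ, 0 ≤ (c * w).re * (d * w).re := by
    intro w
    rcases eq_or_ne w 0 with rfl | hw
    · simp
    let u : Circle := ⟨w / ‖w‖, by simp [Submonoid.unitSphere, hw]⟩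
    have hx := h ((AddCircle.homeomorphCircle one_ne_zero).symm u)
    have hu : chi ((AddCircle.homeomorphCircle one_ne_zero).symm u) = w / ‖w‖ := by
      rw [chi, ← AddCircle.homeomorphCircle_apply one_ne_zero, Homeomorph.apply_symm_apply]
    have hwu : w = (‖w‖ : ℂ) * (w / ‖w‖) := by
      have : (‖w‖ : ℂ) ≠ 0 := by simpa using hw
      field_simp
    rw [hu] at hx
    rw [hwu, mul_left_comm, mul_left_comm d, Complex.re_ofReal_mul, Complex.re_ofReal_mul,
      mul_mul_mul_comm]
    positivity
  set e := d / c with he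
  have hquad : ∀ y : ℝ, 0 ≤ e.re - e.im * y := by
    intro y
    -- This `w` makes the first factor 1 and the second an affine function of y, whose slope must
    -- therefore vanish.
    have := hall ((1 + y * Complex.I) / c)
    rw [mul_div_cancel₀ _ hc, ← mul_div_assoc, mul_div_right_comm, ← he] at this
    simpa using this
  have him : e.im = 0 := by
    by_contra hne
    have := hquad ((e.re + 1) / e.im)
    rw [mul_div_cancel₀ _ hne] at this
    linarith
  have hre : e = e.re := Complex.ext rfl (by simpa using him)
  have hre0 : e.re ≠ 0 := fun h0 => div_ne_zero hd hc (by rw [← he, hre, h0, Complex.ofReal_zero])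
  refine ⟨e.re, lt_of_le_of_ne (by simpa using hquad 0) hre0.symm, ?_⟩
  rw [← hre, he, div_mul_cancel₀ _ hc]

theorem forall_nonneg_of_ae {f : UnitAddCircle → ℝ} (hf : Continuous f)
    (h : ∀ᵐ x ∂arc, 0 ≤ f x) (x : UnitAddCircle) : 0 ≤ f x := by
  by_contra! hx
  have hopen : IsOpen {x | f x < 0} := isOpen_lt hf continuous_const
  have hnull : arc {x | f x < 0} = 0 := by
    rw [ae_iff] at h
    simpa using h
  rw [hopen.measure_eq_zero_iff arc] at hnull
  exact (hnull ▸ hx : x ∈ (∅ : Set UnitAddCircle))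

theorem band_eq_re (c : ℂ) (x : UnitAddCircle) :
    c * chi x + conj (c * chi x) = ((2 * (c * chi x).re : ℝ) : ℂ) := Complex.add_conj _

theorem ModulusIdentity.eq_re {φ : RealLinf} {g : L2} {c : ℂ} (h : ModulusIdentity φ g c) :
    ∀ᵐ x ∂arc, φ x * ‖g x‖ ^ 2 = 2 * (c * chi x).re := by
  filter_upwards [h] with x hx
  rw [band_eq_re] at hx
  exact_mod_cast hx

/-- Multiplying cχ + (cχ)^* by χ gives cχ² + c̄, a nonzero element of H². -/
theorem ae_re_mul_chi_ne_zero {c : ℂ} (hc : c ≠ 0) : ∀ᵐ x ∂arc, (c * chi x).re ≠ 0 := by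
  let p : L2 := c • fourierLp (T := 1) 2 2 + conj c • fourierLp (T := 1) 2 0
  have hp : p ∈ H2 := H2.add_mem (H2.smul_mem _ (fourierLp_mem_H2 (by norm_num)))
    (H2.smul_mem _ (fourierLp_mem_H2 le_rfl))
  have hp0 : p ≠ 0 := by
    intro h0
    have h1 : fourierCoeff p 0 = conj c := by
      simp only [p, fourierCoeff_add', fourierCoeff_smul', fourierCoeff_fourierLp]
      simp
    rw [h0, fourierCoeff_zero'] at h1
    exact (map_ne_zero _).2 hc h1.symm
  filter_upwards [ae_ne_zero_of_mem_H2 hp hp0, Lp.coeFn_add (c • fourierLp (T := 1) 2 2)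
    (conj c • fourierLp (T := 1) 2 0), Lp.coeFn_smul c (fourierLp (T := 1) 2 2),
    Lp.coeFn_smul (conj c) (fourierLp (T := 1) 2 0), coeFn_fourierLp (T := 1) 2 2,
    coeFn_fourierLp (T := 1) 2 0] with x h1 h2 h3 h4 h5 h6 h0
  refine h1 ?_
  have hfac : p x = fourier 1 x * (c * chi x + conj (c * chi x)) := by
    rw [conj_chi_mul, chi_eq_fourier]
    change (c • fourierLp (T := 1) 2 2 + conj c • fourierLp (T := 1) 2 0 : L2) x = _
    rw [h2, Pi.add_apply, h3, h4, Pi.smul_apply, Pi.smul_apply, h5, h6, smul_eq_mul, smul_eq_mul,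
      mul_add, mul_left_comm, ← fourier_add, mul_left_comm, ← fourier_add]
    norm_num
  rw [hfac, band_eq_re, h0]
  simp

/-- If `g` is outer, `h ∈ H²` and `h / g` is bounded, then `h / g` has no Fourier coefficients of
negative index. -/
theorem fourierCoeff_div_eq_zero {g h : L2} (hg : IsOuter g) (hh : h ∈ H2)
    (hb : MemLp (fun x => h x / g x) ∞ arc) {n : ℤ} (hn : n < 0) :
    fourierCoeff (fun x => h x / g x) n = 0 := by
  -- Multiplication by `h / g` sends `a g` to `a h`, so by density it maps H² into H²; it is then
  -- applied to 1.
  have hle : H2 ≤ H2.comap (mulCLM _ hb).toLinearMap := by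
    refine hg.H2_le (isClosed_H2.preimage (mulCLM _ hb).continuous) ?_
    rintro f ⟨a, ha, hf⟩
    refine IsDiscAlgebraMultiple.mem_H2 ⟨a, ha, ?_⟩ hh
    filter_upwards [coeFn_mulCLM _ hb f, hf, ae_ne_zero_of_mem_H2 hg.1 hg.ne_zero] with x h1 h2 h3
    rw [ContinuousLinearMap.coe_coe, h1, h2]
    field_simp
  rw [← hle (fourierLp_mem_H2 le_rfl) n hn, ContinuousLinearMap.coe_coe]
  refine congrFun (fourierCoeff_congr_ae ?_) _
  filter_upwards [coeFn_mulCLM _ hb (fourierLp (T := 1) 2 0), coeFn_fourierLp (T := 1) 2 0]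
    with x h1 h2
  rw [h1, h2, fourier_zero, mul_one]

theorem memLp_top_div {g h : L2} {t : ℝ} (ht : 0 ≤ t) (hgh : ∀ᵐ x ∂arc, ‖h x‖ ^ 2 = t * ‖g x‖ ^ 2) :
    MemLp (fun x => h x / g x) ∞ arc := by
  refine memLp_top_of_bound ((Lp.aestronglyMeasurable h).div₀ (Lp.aestronglyMeasurable g)) (√t) ?_
  filter_upwards [hgh] with x hx
  rw [norm_div]
  refine div_le_of_le_mul₀ (norm_nonneg _) (Real.sqrt_nonneg _) ?_
  refine le_of_sq_le_sq ?_ (by positivity)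
  rw [hx, mul_pow, Real.sq_sqrt ht]

/-- Outer functions with proportional moduli are proportional. -/
theorem IsOuter.exists_eq_smul {g h : L2} (hg : IsOuter g) (hh : IsOuter h) {t : ℝ} (ht : 0 < t)
    (hgh : ∀ᵐ x ∂arc, ‖h x‖ ^ 2 = t * ‖g x‖ ^ 2) : ∃ l : ℂ, h = l • g := by
  have hhg : ∀ᵐ x ∂arc, ‖g x‖ ^ 2 = t⁻¹ * ‖h x‖ ^ 2 := by
    filter_upwards [hgh] with x hx
    rw [hx]
    field_simp
  have hu := memLp_top_div ht.le hgh
  have hv := memLp_top_div (inv_pos.2 ht).le hhg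
  have hgne := ae_ne_zero_of_mem_H2 hg.1 hg.ne_zero
  have hhne := ae_ne_zero_of_mem_H2 hh.1 hh.ne_zero
  -- Since |h/g|² = t, the quotient is both analytic and, through `g / h`, conjugate analytic; hence
  -- it is constant.
  have huv : (fun x => h x / g x) =ᵐ[arc] fun x => (t : ℂ) * conj (g x / h x) := by
    filter_upwards [hgh, hgne, hhne] with x h1 h2 h3
    have h4 : conj (h x) ≠ 0 := (map_ne_zero _).2 h3
    have h5 : h x * conj (h x) = t * (g x * conj (g x)) := by
      rw [Complex.mul_conj, Complex.mul_conj, Complex.normSq_eq_norm_sq,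
        Complex.normSq_eq_norm_sq, h1, Complex.ofReal_mul]
    rw [map_div₀]
    field_simp
    linear_combination h5
  set l := fourierCoeff (fun x => h x / g x) 0 with hl
  have hint : Integrable (fun x => h x / g x) arc := hu.integrable le_top
  have hae : (fun x => h x / g x - l) =ᵐ[arc] 0 := by
    refine ae_eq_zero_of_fourierCoeff_eq_zero (hint.sub (integrable_const _)) fun n => ?_
    have hsub : fourierCoeff (fun x => h x / g x - l) n =
        fourierCoeff (fun x => h x / g x) n - fourierCoeff (fun _ : UnitAddCircle => l) n := by
      simp only [fourierCoeff, smul_sub]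
      exact integral_sub (hint.fourier_smul _) ((integrable_const l).fourier_smul _)
    rw [hsub, fourierCoeff_const]
    rcases lt_trichotomy n 0 with hn | rfl | hn
    · simp [fourierCoeff_div_eq_zero hg hh.1 hu hn, hn.ne]
    · simp [hl]
    · rw [fourierCoeff_congr_ae huv, fourierCoeff.const_mul (T := 1), fourierCoeff_conj,
        fourierCoeff_div_eq_zero hh hg.1 hv (neg_neg_of_pos hn)]
      simp [hn.ne']
  refine ⟨l, Lp.ext ?_⟩
  filter_upwards [hae, hgne, Lp.coeFn_smul l g] with x h1 h2 h3
  rw [h3, Pi.smul_apply, smul_eq_mul, ← sub_eq_zero.1 h1, div_mul_cancel₀ _ h2]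

theorem exists_smul_of_modulusIdentity {φ : RealLinf} (hφ : φ ≠ 0) {g h : L2} {c d : ℂ}
    (hg : IsOuter g) (hh : IsOuter h) (hgc : ModulusIdentity φ g c)
    (hhd : ModulusIdentity φ h d) : ∃ l : ℂ, h = l • g := by
  have hc := hgc.ne_zero hφ hg.1 hg.ne_zero
  have hd := hhd.ne_zero hφ hh.1 hh.ne_zero
  have hcont : ∀ e : ℂ, Continuous fun x => (e * chi x).re := fun e =>
    Complex.continuous_re.comp (continuous_const.mul continuous_chi)
  obtain ⟨t, ht, rfl⟩ := exists_pos_mul_of_re_mul_re_nonneg hc hd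
    (forall_nonneg_of_ae ((hcont c).mul (hcont d)) (by
      filter_upwards [hgc.eq_re, hhd.eq_re] with x h1 h2
      -- By the two identities this product is φ²|g|²|h|²/4, so the two trigonometric polynomials
      -- never have opposite signs.
      have : (c * chi x).re * (d * chi x).re = (φ x * ‖g x‖ * ‖h x‖ / 2) ^ 2 := by
        linear_combination (-(d * chi x).re / 2) * h1 - (φ x * ‖g x‖ ^ 2 / 4) * h2
      rw [this]
      positivity))
  refine hg.exists_eq_smul hh ht ?_
  filter_upwards [hgc.eq_re, hhd.eq_re, ae_re_mul_chi_ne_zero hc] with x h1 h2 h3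
  have hφx : φ x ≠ 0 := by
    intro h0
    rw [h0, zero_mul] at h1
    exact h3 (by linarith)
  rw [mul_assoc, Complex.re_ofReal_mul] at h2
  refine mul_left_cancel₀ hφx ?_
  linear_combination h2 - t * h1

/-! ### Uniqueness of the space and dimension of the kernel -/

theorem exists_smul_of_toeplitz_eq_zero {φ : RealLinf} (hφ : φ ≠ 0) {V W : Submodule ℂ L2}
    (hV : V ≤ affinePolys) (hW : W ≤ affinePolys) {g : H2V V} {h : H2V W} (hg0 : g ≠ 0)
    (hh0 : h ≠ 0) (hg : toeplitz φ V g = 0) (hh : toeplitz φ W h = 0) :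
    ∃ l : ℂ, (h : L2) = l • (g : L2) := by
  obtain ⟨c, hc⟩ := exists_modulusIdentity hV hg
  obtain ⟨d, hd⟩ := exists_modulusIdentity hW hh
  exact exists_smul_of_modulusIdentity hφ (isOuter_of_toeplitz_eq_zero hφ hV hg0 hg)
    (isOuter_of_toeplitz_eq_zero hφ hW hh0 hh) hc hd

theorem eq_of_toeplitz_eq_zero {φ : RealLinf} (hφ : φ ≠ 0) {V W : Submodule ℂ L2}
    (hV : V ≤ affinePolys) (hW : W ≤ affinePolys) {g : H2V V} {h : H2V W} (hg0 : g ≠ 0)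
    (hh0 : h ≠ 0) (hg : toeplitz φ V g = 0) (hh : toeplitz φ W h = 0) : V = W := by
  obtain ⟨c, hc⟩ := exists_modulusIdentity hV hg
  have hout := isOuter_of_toeplitz_eq_zero hφ hV hg0 hg
  obtain ⟨l, hl⟩ := exists_smul_of_toeplitz_eq_zero hφ hW hV hh0 hg0 hh hg
  -- Being a multiple of `h`, the function `g` is in the kernel for both spaces, and each is the
  -- space determined by `g`.
  have hgW : (g : L2) ∈ H2V W := hl ▸ (H2V W).smul_mem l h.2
  have hTW : toeplitz φ W ⟨g, hgW⟩ = 0 := by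
    rw [show (⟨g, hgW⟩ : H2V W) = l • h from Subtype.ext hl, map_smul, hh, smul_zero]
  rw [eq_determinedSpace hφ hout hc hV g.2 hg, ← eq_determinedSpace hφ hout hc hW hgW hTW]

theorem exists_of_hasEigenvalue_zero {φ : RealLinf} {V : Submodule ℂ L2}
    (h : Module.End.HasEigenvalue (toeplitz φ V) 0) :
    ∃ g : H2V V, g ≠ 0 ∧ toeplitz φ V g = 0 := by
  obtain ⟨g, hg⟩ := h.exists_hasEigenvector
  exact ⟨g, hg.2, by simpa using hg.apply_eq_smul⟩

theorem rank_eigenspace_zero_le_one {φ : RealLinf} (hφ : φ ≠ 0) {V : Submodule ℂ L2}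
    (hV : V ≤ affinePolys) :
    Module.rank ℂ (Module.End.eigenspace (toeplitz φ V) 0) ≤ 1 := by
  have hker : ∀ f : Module.End.eigenspace (toeplitz φ V) 0, toeplitz φ V f = 0 := fun f => by
    simpa using Module.End.mem_eigenspace_iff.1 f.2
  rw [rank_le_one_iff]
  by_cases hex : ∃ g : Module.End.eigenspace (toeplitz φ V) 0, g ≠ 0
  · obtain ⟨g, hg0⟩ := hex
    refine ⟨g, fun f => ?_⟩
    by_cases hf0 : f = 0
    · exact ⟨0, by rw [hf0, zero_smul]⟩
    obtain ⟨l, hl⟩ := exists_smul_of_toeplitz_eq_zero hφ hV hV (fun h => hg0 (Subtype.ext h))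
      (fun h => hf0 (Subtype.ext h)) (hker g) (hker f)
    exact ⟨l, Subtype.ext (Subtype.ext hl.symm)⟩
  · push Not at hex
    exact ⟨0, fun f => ⟨0, by rw [hex f, zero_smul]⟩⟩

end NeilToeplitz

end

theorem theorem3p1 (φ : NeilToeplitz.RealLinf) (hφ : φ ≠ 0) :
    -- every nonzero element of the kernel is outer and satisfies the identity
    (∀ V : Submodule ℂ NeilToeplitz.L2, V ≤ NeilToeplitz.affinePolys →
      ∀ g : NeilToeplitz.H2V V, g ≠ 0 → NeilToeplitz.toeplitz φ V g = 0 →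
        NeilToeplitz.IsOuter (g : NeilToeplitz.L2) ∧
          ∃ c : ℂ, NeilToeplitz.ModulusIdentity φ (g : NeilToeplitz.L2) c) ∧
    -- conversely, an outer function with the identity is in the kernel for exactly one space
    (∀ (c : ℂ) (g : NeilToeplitz.L2), NeilToeplitz.IsOuter g →
      NeilToeplitz.ModulusIdentity φ g c →
        ∀ V : Submodule ℂ NeilToeplitz.L2, V ≤ NeilToeplitz.affinePolys →
          ((∃ hg : g ∈ NeilToeplitz.H2V V, NeilToeplitz.toeplitz φ V ⟨g, hg⟩ = 0) ↔
            V = NeilToeplitz.determinedSpace (NeilToeplitz.toDisc g 0)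
              (deriv (NeilToeplitz.toDisc g) 0))) ∧
    -- at most one space gives the eigenvalue `0`
    (∀ V W : Submodule ℂ NeilToeplitz.L2,
      V ≤ NeilToeplitz.affinePolys → W ≤ NeilToeplitz.affinePolys →
        Module.End.HasEigenvalue (NeilToeplitz.toeplitz φ V) 0 →
          Module.End.HasEigenvalue (NeilToeplitz.toeplitz φ W) 0 → V = W) ∧
    -- the eigenspace has dimension at most one
    (∀ V : Submodule ℂ NeilToeplitz.L2, V ≤ NeilToeplitz.affinePolys →
      Module.rank ℂ (Module.End.eigenspace (NeilToeplitz.toeplitz φ V) 0) ≤ 1) := by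

  refine ⟨fun V hV g hg0 hT => ⟨NeilToeplitz.isOuter_of_toeplitz_eq_zero hφ hV hg0 hT,
    NeilToeplitz.exists_modulusIdentity hV hT⟩, fun c g hg hid V hV => ?_,
    fun V W hV hW hVe hWe => ?_, fun V hV => NeilToeplitz.rank_eigenspace_zero_le_one hφ hV⟩
  · rw [NeilToeplitz.toDisc_zero, NeilToeplitz.deriv_toDisc_zero]
    refine ⟨fun ⟨hgV, hT⟩ => NeilToeplitz.eq_determinedSpace hφ hg hid hV hgV hT, ?_⟩
    rintro rfl
    exact NeilToeplitz.exists_mem_H2V_and_toeplitz_eq_zero hg hid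
  · obtain ⟨g, hg0, hg⟩ := NeilToeplitz.exists_of_hasEigenvalue_zero hVe
    obtain ⟨h, hh0, hh⟩ := NeilToeplitz.exists_of_hasEigenvalue_zero hWe
    exact NeilToeplitz.eq_of_toeplitz_eq_zero hφ hV hW hg0 hh0 hg hh
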